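/- Let $k,\ell\ge 3$ be integers. A $(k,\ell)$-partition is a partition of $\{1,\dots,k\ell\}$ into exactly $\ell$ blocks, each of size $k$. Let $X_{k,\ell}$ be the graph whose vertices are all $(k,\ell)$-partitions, in which two distinct partitions $P,Q$ are adjacent if and only if $|B\cap C|\le 1$ for every block $B$ of $P$ and every block $C$ of $Q$. Then $X_{k,\ell}$ is regular; let $d$ be its degree. The number \[ \theta=\frac{2(k-1)(k-2)\,d}{k^{2}(\ell-1)(\ell-2)} \] is an eigenvalue of (the adjacency matrix of) $X_{k,\ell}$, and its multiplicity is at least $\binom{k\ell}{3}-\binom{k\ell}{2}$. Moreover, the setwise stabiliser of $\{1,2,3\}$ in the symmetric group $\mathrm{Sym}(k\ell)$ has exactly three orbits on the $(k,\ell)$-partitions. These orbits form an equitable partition of $X_{k,\ell}$, that is, there is a $3\times 3$ matrix $M$, indexed by the orbits, such that every vertex in orbit $i$ has exactly $M_{ij}$ neighbours in orbit $j$; and $\theta$ is an eigenvalue of this quotient matrix $M$. -/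

import Mathlib

open scoped Pointwise

/-- `(k, ℓ)`-partitions: partitions of the `kℓ`-element set `Fin (k * ℓ)` into `ℓ` blocks,
each of size `k`. -/
abbrev KLPartition (k l : ℕ) : Type :=
  {P : Finpartition (Finset.univ : Finset (Fin (k * l))) //
    P.parts.card = l ∧ ∀ B ∈ P.parts, B.card = k}

/-- The image of a partition under a permutation `σ` of the points: its blocks are the sets
`σ(B)`, with `B` a block of `P`. -/
def permuteFinpartition {n : ℕ} (σ : Equiv.Perm (Fin n))
    (P : Finpartition (Finset.univ : Finset (Fin n))) :
    Finpartition (Finset.univ : Finset (Fin n)) :=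
  Finpartition.ofExistsUnique (P.parts.image fun B => B.image σ)
    (fun _ _ => Finset.subset_univ _)
    (by
      intro a _
      obtain ⟨B, ⟨hB, haB⟩, huniq⟩ := P.existsUnique_mem (Finset.mem_univ (σ.symm a))
      refine ⟨B.image σ, ⟨Finset.mem_image_of_mem _ hB, ?_⟩, ?_⟩
      · exact Finset.mem_image.2 ⟨_, haB, by simp⟩
      · rintro C ⟨hC, haC⟩
        obtain ⟨B', hB', rfl⟩ := Finset.mem_image.1 hC
        obtain ⟨b, hb, rfl⟩ := Finset.mem_image.1 haC
        rw [huniq B' ⟨hB', by simpa using hb⟩])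
    (by
      intro h
      obtain ⟨B, hB, hE⟩ := Finset.mem_image.1 h
      exact P.bot_notMem (by
        rw [Finset.image_eq_empty.1 hE] at hB
        exact hB))

theorem permuteFinpartition_parts {n : ℕ} (σ : Equiv.Perm (Fin n))
    (P : Finpartition (Finset.univ : Finset (Fin n))) :
    (permuteFinpartition σ P).parts = P.parts.image fun B => B.image σ := rfl

/-- The natural action of the symmetric group on `(k, ℓ)`-partitions. -/
instance instMulActionPermKLPartition (k l : ℕ) :
    MulAction (Equiv.Perm (Fin (k * l))) (KLPartition k l) where
  smul σ P := ⟨permuteFinpartition σ P.1, by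
    rw [permuteFinpartition_parts,
      Finset.card_image_of_injective _ (Finset.image_injective σ.injective)]
    exact P.2.1, by
    intro B hB
    rw [permuteFinpartition_parts] at hB
    obtain ⟨C, hC, rfl⟩ := Finset.mem_image.1 hB
    rw [Finset.card_image_of_injective _ σ.injective]
    exact P.2.2 C hC⟩
  one_smul P := by
    apply Subtype.ext
    apply Finpartition.ext
    change P.1.parts.image (fun B => B.image (1 : Equiv.Perm (Fin (k * l)))) = P.1.parts
    simp
  mul_smul σ τ P := by
    apply Subtype.ext
    apply Finpartition.ext
    change P.1.parts.image (fun B => B.image (σ * τ : Equiv.Perm (Fin (k * l)))) =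
      (P.1.parts.image (fun B => B.image τ)).image (fun B => B.image σ)
    simp [Finset.image_image, Function.comp_def]

/-- The graph `X_{k,ℓ}` on the `(k, ℓ)`-partitions: distinct `P` and `Q` are adjacent when every
block of `P` and every block of `Q` have at most one element in common. (For `k ≥ 2` the
condition `P ≠ Q` is implied by the other one.) -/
def partitionGraph (k l : ℕ) : SimpleGraph (KLPartition k l) where
  Adj P Q := P ≠ Q ∧ ∀ B ∈ P.1.parts, ∀ C ∈ Q.1.parts, (B ∩ C).card ≤ 1
  symm := ⟨fun _ _ h => ⟨h.1.symm, fun B hB C hC => by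
    rw [Finset.inter_comm]
    exact h.2 C hC B hB⟩⟩
  loopless := ⟨fun _ h => h.1 rfl⟩

/-- The setwise stabiliser, in the symmetric group on `Fin n`, of the first three points
`0, 1, 2` (the points called `1, 2, 3` when counting from one). -/
abbrev firstThreeStabilizer (n : ℕ) : Subgroup (Equiv.Perm (Fin n)) :=
  MulAction.stabilizer (Equiv.Perm (Fin n)) {x : Fin n | x.val < 3}

/-- The orbits of the setwise stabiliser of the first three points on the
`(k, ℓ)`-partitions. -/
abbrev FirstThreeOrbit (k l : ℕ) : Type :=
  MulAction.orbitRel.Quotient (firstThreeStabilizer (k * l)) (KLPartition k l)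

/-- `M` is the quotient matrix of the graph `G` with respect to the partition of its vertices into
the fibres of `c`: every vertex in cell `i` has exactly `M i j` neighbours in cell `j`. In
particular this partition is equitable. -/
def IsQuotientMatrix {V I : Type*} (G : SimpleGraph V) (c : V → I) (M : Matrix I I ℝ) : Prop :=
  ∀ (v : V) (j : I), M (c v) j = (({w : V | G.Adj v w ∧ c w = j}.ncard : ℕ) : ℝ)

/-! Harmonic functions on triples become eigenvectors on partitions under `blockSum`. Summing
`blockSum g` over the neighbours of `P` counts each triple `S` once for every neighbour with a block
containing `S`. Such a neighbour exists only if `S` is rainbow for `P`, and then by symmetry the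
number of them is a constant `N`. So the neighbour sum is `N` times the rainbow sum of `g`. A triple
meeting 1, 2 or 3 blocks has 3, 1 or 0 pairs inside blocks, that is, 1 + 2[mono] - [rainbow]. For
harmonic `g` the sums over pairs and over all triples vanish, so the rainbow sum is twice the block
sum and the eigenvalue is `2 * N`. Taking `g = 1` in the same neighbour sum expresses `N` through
the degree.

For the multiplicity, harmonic functions form the kernel of a map from triples to pairs, so
rank-nullity bounds their dimension below. Block sums are injective on them
(`IsHarmonic.eq_zero_of_blockSum`): averaging over the partitions with a given block `B` recovers
the sum of `g` inside `B`, up to a nonzero factor. If these sums vanish for all `k`-sets, they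
vanish for larger sets up to complements of triples, and complementation only changes the sign.

For the quotient, the orbit of a partition records how it splits the fixed triple. The zonal
harmonic of that triple is stabiliser-invariant, so its block sum, nonzero by injectivity, descends
to an eigenvector of the quotient matrix. -/

/-! ### Harmonic functions on triples -/

section Harmonic

variable {α : Type*} [Fintype α] [DecidableEq α]

open Finset

/-- Pairing a weight on pairs with the sums of `g` over the triples containing a given pair. -/
theorem sum_pairs_mul_sum_insert (w g : Finset α → ℝ) :
    ∑ p ∈ powersetCard 2 univ, w p * ∑ x ∈ pᶜ, g (insert x p) =
      ∑ S ∈ powersetCard 3 univ, g S * ∑ x ∈ S, w (S.erase x) := by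
  simp_rw [mul_sum]
  rw [sum_sigma', sum_sigma']
  refine sum_bij' (fun a _ => ⟨insert a.2 a.1, a.2⟩) (fun a _ => ⟨a.1.erase a.2, a.2⟩)
    ?_ ?_ ?_ ?_ ?_
  · rintro ⟨p, x⟩ h
    simp only [mem_sigma, mem_powersetCard_univ, mem_compl] at h ⊢
    exact ⟨by rw [card_insert_of_notMem h.2, h.1], mem_insert_self _ _⟩
  · rintro ⟨S, x⟩ h
    simp only [mem_sigma, mem_powersetCard_univ, mem_compl] at h ⊢
    exact ⟨by rw [card_erase_of_mem h.2, h.1], notMem_erase _ _⟩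
  · rintro ⟨p, x⟩ h
    simp only [mem_sigma, mem_compl] at h
    simp [erase_insert h.2]
  · rintro ⟨S, x⟩ h
    simp only [mem_sigma] at h
    simp [insert_erase h.2]
  · rintro ⟨p, x⟩ h
    simp only [mem_sigma, mem_compl] at h
    simp [erase_insert h.2, mul_comm]

/-- All elements of `S` have the same colour. -/
abbrev IsMonochromatic {β : Type*} (c : α → β) (S : Finset α) : Prop :=
  ∀ y ∈ S, ∀ z ∈ S, c y = c z

/-- Distinct elements of `S` have distinct colours. -/
abbrev IsRainbowFor {β : Type*} (c : α → β) (S : Finset α) : Prop :=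
  ∀ y ∈ S, ∀ z ∈ S, c y = c z → y = z

/-- The number of monochromatic pairs in a coloured triple. -/
theorem sum_erase_monochromatic {β : Type*} [DecidableEq β] (c : α → β) {S : Finset α}
    (hS : S.card = 3) :
    ∑ x ∈ S, (if IsMonochromatic c (S.erase x) then (1 : ℝ) else 0) =
      1 + (2 * (if IsMonochromatic c S then 1 else 0) - (if IsRainbowFor c S then 1 else 0)) := by
  obtain ⟨a, b, d, hab, had, hbd, rfl⟩ := card_eq_three.1 hS
  have e1 : ({a, b, d} : Finset α).erase a = {b, d} := by grind
  have e2 : ({a, b, d} : Finset α).erase b = {a, d} := by grind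
  have e3 : ({a, b, d} : Finset α).erase d = {a, b} := by grind
  rw [sum_insert (by grind), sum_insert (by grind), sum_singleton, e1, e2, e3]
  have m : ∀ x y, IsMonochromatic c {x, y} ↔ c x = c y := by
    intro x y; simp [IsMonochromatic]; grind
  have m3 : IsMonochromatic c {a, b, d} ↔ c a = c b ∧ c b = c d := by
    simp [IsMonochromatic]; grind
  have r3 : IsRainbowFor c {a, b, d} ↔ c a ≠ c b ∧ c b ≠ c d ∧ c a ≠ c d := by
    simp [IsRainbowFor]; grind
  simp only [m, m3, r3]
  split_ifs <;> first | (norm_num; done) | (exfalso; grind)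

/-- Double counting of monochromatic pairs inside triples, weighted by `g`. It serves twice: for
harmonic `g`, where the right side vanishes, and for `g = 1`, where it counts rainbow triples. -/
theorem two_mul_sum_monochromatic_sub_sum_rainbow {β : Type*} [DecidableEq β] (c : α → β)
    (g : Finset α → ℝ) :
    2 * ∑ S ∈ powersetCard 3 univ with IsMonochromatic c S, g S -
        ∑ S ∈ powersetCard 3 univ with IsRainbowFor c S, g S =
      ∑ p ∈ powersetCard 2 univ with IsMonochromatic c p, ∑ x ∈ pᶜ, g (insert x p) -
        ∑ S ∈ powersetCard 3 univ, g S := by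
  have h := sum_pairs_mul_sum_insert (fun p => if IsMonochromatic c p then (1 : ℝ) else 0) g
  have h' : ∀ S ∈ powersetCard 3 (univ : Finset α),
      g S * ∑ x ∈ S, (if IsMonochromatic c (S.erase x) then (1 : ℝ) else 0) = _ := fun S hS => by
    rw [sum_erase_monochromatic c (mem_powersetCard_univ.1 hS)]
  rw [sum_congr rfl h'] at h
  simp only [ite_mul, one_mul, zero_mul] at h
  simp only [sum_filter]
  rw [h, mul_sum, ← sum_sub_distrib, ← sum_sub_distrib]
  refine sum_congr rfl fun S _ => ?_
  split_ifs <;> ring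

/-- A function on triples is harmonic if its sum over the triples containing a given pair is
always zero. -/
def IsHarmonic (g : Finset α → ℝ) : Prop :=
  ∀ p : Finset α, p.card = 2 → ∑ x ∈ pᶜ, g (insert x p) = 0

theorem IsHarmonic.sum_triples {g : Finset α → ℝ} (hg : IsHarmonic g) :
    ∑ S ∈ powersetCard 3 univ, g S = 0 := by
  have h := sum_pairs_mul_sum_insert (fun _ => (1 : ℝ)) g
  have hl : ∀ p ∈ powersetCard 2 (univ : Finset α), (1 : ℝ) * ∑ x ∈ pᶜ, g (insert x p) = 0 :=
    fun p hp => by rw [hg p (mem_powersetCard_univ.1 hp), mul_zero]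
  have hr : ∀ S ∈ powersetCard 3 (univ : Finset α), g S * ∑ x ∈ S, (1 : ℝ) = g S * 3 :=
    fun S hS => by simp [mem_powersetCard_univ.1 hS]
  rw [sum_eq_zero hl, sum_congr rfl hr, ← sum_mul] at h
  linarith

theorem IsHarmonic.sum_rainbow {β : Type*} [DecidableEq β] (c : α → β) {g : Finset α → ℝ}
    (hg : IsHarmonic g) :
    ∑ S ∈ powersetCard 3 univ with IsRainbowFor c S, g S =
      2 * ∑ S ∈ powersetCard 3 univ with IsMonochromatic c S, g S := by
  have h := two_mul_sum_monochromatic_sub_sum_rainbow c g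
  have hz : ∑ p ∈ powersetCard 2 univ with IsMonochromatic c p, ∑ x ∈ pᶜ, g (insert x p) = 0 :=
    sum_eq_zero fun p hp => hg p (mem_powersetCard_univ.1 (mem_filter.1 hp).1)
  rw [hg.sum_triples, hz] at h
  linarith

/-- The sum of `g` over the triples contained in `B`. -/
def tripleSum (g : Finset α → ℝ) (B : Finset α) : ℝ := ∑ S ∈ powersetCard 3 B, g S

theorem IsHarmonic.tripleSum_compl {g : Finset α → ℝ} (hg : IsHarmonic g) (B : Finset α) :
    tripleSum g Bᶜ = - tripleSum g B := by
  have h := hg.sum_rainbow (fun x => decide (x ∈ B))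
  have hr : ({S ∈ powersetCard 3 univ | IsRainbowFor (fun x => decide (x ∈ B)) S} :
      Finset (Finset α)) = ∅ := by
    refine filter_eq_empty_iff.2 fun S hS => ?_
    obtain ⟨a, b, d, hab, had, hbd, rfl⟩ := card_eq_three.1 (mem_powersetCard_univ.1 hS)
    simp only [IsRainbowFor, decide_eq_decide, mem_insert, mem_singleton, forall_eq_or_imp,
      forall_eq]
    grind
  have hm : ({S ∈ powersetCard 3 univ | IsMonochromatic (fun x => decide (x ∈ B)) S} :
      Finset (Finset α)) = powersetCard 3 B ∪ powersetCard 3 Bᶜ := by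
    ext S
    simp only [mem_filter, mem_union, mem_powersetCard, decide_eq_decide, IsMonochromatic,
      subset_univ, true_and]
    constructor
    · rintro ⟨hS, h⟩
      obtain ⟨a, ha⟩ : S.Nonempty := card_pos.1 (by omega)
      by_cases haB : a ∈ B
      · exact Or.inl ⟨fun y hy => (h a ha y hy).1 haB, hS⟩
      · exact Or.inr ⟨fun y hy => mem_compl.2 fun hyB => haB ((h a ha y hy).2 hyB), hS⟩
    · rintro (⟨h, hS⟩ | ⟨h, hS⟩)
      · exact ⟨hS, fun y hy z hz => by simp [h hy, h hz]⟩
      · exact ⟨hS, fun y hy z hz => by simp [mem_compl.1 (h hy), mem_compl.1 (h hz)]⟩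
  have hd : Disjoint (powersetCard 3 B) (powersetCard 3 Bᶜ) := by
    rw [disjoint_left]
    intro S h1 h2
    rw [mem_powersetCard] at h1 h2
    obtain ⟨a, ha⟩ : S.Nonempty := card_pos.1 (by omega)
    exact mem_compl.1 (h2.1 ha) (h1.1 ha)
  rw [hr, hm, sum_union hd, sum_empty] at h
  unfold tripleSum
  linarith

-- Each triple in `U` survives the deletion of exactly the `U.card - 3` points outside it.
omit [Fintype α] in
theorem sum_tripleSum_erase (g : Finset α → ℝ) (U : Finset α) :
    ∑ u ∈ U, tripleSum g (U.erase u) = ((U.card : ℝ) - 3) * tripleSum g U := by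
  unfold tripleSum
  rw [sum_comm' (t' := powersetCard 3 U) (s' := fun S => U \ S) (by
    intro u S
    simp only [mem_powersetCard, mem_sdiff, subset_erase]
    tauto), mul_sum]
  refine sum_congr rfl fun S hS => ?_
  obtain ⟨hSU, hS3⟩ := mem_powersetCard.1 hS
  rw [sum_const, nsmul_eq_mul, cast_card_sdiff hSU, hS3]
  norm_num

/-- A harmonic function is determined by its sums over the subsets of a fixed size. -/
theorem IsHarmonic.eq_zero_of_tripleSum {g : Finset α → ℝ} (hg : IsHarmonic g) {k : ℕ}
    (hk : 3 ≤ k) (hn : k + 3 ≤ Fintype.card α)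
    (h : ∀ B : Finset α, B.card = k → tripleSum g B = 0) {S : Finset α} (hS : S.card = 3) :
    g S = 0 := by
  -- Vanishing propagates upwards in size: at size `j + 1` the factor `j + 1 - 3` is nonzero because
  -- `j ≥ 3`.
  have key : ∀ j, k ≤ j → ∀ B : Finset α, B.card = j → tripleSum g B = 0 := by
    intro j hj
    induction j, hj using Nat.le_induction with
    | base => exact h
    | succ j hj ih =>
      intro B hB
      have := sum_tripleSum_erase g B
      have hz : ∑ u ∈ B, tripleSum g (B.erase u) = 0 :=
        sum_eq_zero fun u hu => ih _ (by rw [card_erase_of_mem hu, hB]; rfl)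
      rw [hz] at this
      rcases mul_eq_zero.1 this.symm with h0 | h0
      · exfalso
        have : (3 : ℝ) ≤ j := by exact_mod_cast hk.trans hj
        rw [hB] at h0
        push_cast at h0
        linarith
      · exact h0
  have h1 := key _ (by omega) Sᶜ (card_compl S)
  rw [hg.tripleSum_compl] at h1
  have h2 : tripleSum g S = g S := by
    unfold tripleSum
    rw [← hS, powersetCard_self, sum_singleton]
  linarith

/-! ### The zonal harmonic of a triple -/

/-- The value of `zonalHarmonic` on triples meeting the base triple in `i` of the `n` points. -/
def zonalValue (n : ℝ) (i : ℕ) : ℝ :=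
  match i with
  | 0 => -6
  | 1 => 2 * (n - 5)
  | 2 => -((n - 4) * (n - 5))
  | _ => (n - 3) * (n - 4) * (n - 5)

/-- The harmonic function whose value on a triple `S` depends only on `|S ∩ S₀|`. -/
def zonalHarmonic (S₀ S : Finset α) : ℝ := zonalValue (Fintype.card α) (S ∩ S₀).card

/-- If `p` meets `S₀` in `i` points, then `3 - i` extensions of `p` meet it in `i + 1` points and
the other `n - 5 + i` in `i`. Harmonicity is thus `(3 - i) z(i+1) + (n - 5 + i) z(i) = 0` for `i =
0, 1, 2`, the recursion solved by `zonalValue`. -/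
theorem isHarmonic_zonalHarmonic {S₀ : Finset α} (hS₀ : S₀.card = 3) :
    IsHarmonic (zonalHarmonic S₀) := by
  intro p hp
  have hi : ∀ x ∈ pᶜ, (insert x p ∩ S₀).card = (p ∩ S₀).card + if x ∈ S₀ then 1 else 0 := by
    intro x hx
    split_ifs with h
    · rw [insert_inter_of_mem h, card_insert_of_notMem (by
        simp [mem_compl.1 hx])]
    · rw [insert_inter_of_notMem h, add_zero]
  have e1 : ({x ∈ pᶜ | x ∈ S₀} : Finset α) = S₀ \ p := by ext; simp [and_comm]
  have e2 : ({x ∈ pᶜ | x ∉ S₀} : Finset α) = univ \ (p ∪ S₀) := by ext; simp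
  have hu := card_union_add_card_inter p S₀
  have hle : (p ∩ S₀).card ≤ 2 := hp ▸ card_le_card inter_subset_left
  have c1 : ((S₀ \ p).card : ℝ) = 3 - (p ∩ S₀).card := by
    rw [card_sdiff, hS₀, Nat.cast_sub (by omega)]; simp
  have c2 : ((univ \ (p ∪ S₀)).card : ℝ) = Fintype.card α - (5 - (p ∩ S₀).card) := by
    rw [cast_card_sdiff (subset_univ _), card_univ]
    have : ((p ∪ S₀).card : ℝ) + (p ∩ S₀).card = 5 := by
      rw [hp, hS₀] at hu; exact_mod_cast hu
    linarith
  rw [← sum_filter_add_sum_filter_not pᶜ (fun x => x ∈ S₀), e1, e2]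
  have s1 : ∀ x ∈ S₀ \ p, (insert x p ∩ S₀).card = (p ∩ S₀).card + 1 := fun x hx => by
    rw [hi x (by simp [(mem_sdiff.1 hx).2]), if_pos (mem_sdiff.1 hx).1]
  have s2 : ∀ x ∈ univ \ (p ∪ S₀), (insert x p ∩ S₀).card = (p ∩ S₀).card := fun x hx => by
    simp only [mem_sdiff, mem_univ, mem_union, not_or, true_and] at hx
    rw [hi x (by simp [hx.1]), if_neg hx.2, add_zero]
  unfold zonalHarmonic
  rw [sum_congr rfl fun x hx => congrArg _ (s1 x hx),
    sum_congr rfl fun x hx => congrArg _ (s2 x hx)]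
  rw [sum_const, sum_const, nsmul_eq_mul, nsmul_eq_mul, c1, c2]
  generalize (p ∩ S₀).card = i at hle
  interval_cases i <;> norm_num [zonalValue] <;> ring

theorem zonalHarmonic_self_ne_zero {S₀ : Finset α} (hS₀ : S₀.card = 3)
    (hn : 6 ≤ Fintype.card α) : zonalHarmonic S₀ S₀ ≠ 0 := by
  have : (6 : ℝ) ≤ Fintype.card α := by exact_mod_cast hn
  simp only [zonalHarmonic, zonalValue, inter_self, hS₀]
  exact mul_ne_zero (mul_ne_zero (by linarith) (by linarith)) (by linarith)

end Harmonic

/-! ### Partitions, triples and the action of the symmetric group -/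

section Partitions

open Finset

/-- Bijections between corresponding fibres glue together. The permutations of points built below
come from suitable colourings. -/
theorem exists_equiv_of_card_fiber {α β γ : Type*} [Fintype α] [Fintype β] [DecidableEq γ]
    (f : α → γ) (g : β → γ)
    (h : ∀ c, ({x | f x = c} : Finset α).card = ({y | g y = c} : Finset β).card) :
    ∃ e : α ≃ β, ∀ x, g (e x) = f x := by
  have e : ∀ c, Nonempty ({a // f a = c} ≃ {b // g b = c}) := fun c => by
    rw [← Fintype.card_eq, Fintype.card_subtype, Fintype.card_subtype]
    exact h c
  exact ⟨Equiv.ofFiberEquiv fun c => (e c).some, fun x => Equiv.ofFiberEquiv_map _ x⟩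

variable {k l : ℕ}

theorem smul_parts (σ : Equiv.Perm (Fin (k * l))) (P : KLPartition k l) :
    (σ • P).1.parts = P.1.parts.image fun B => B.image σ := rfl

theorem image_mem_smul_parts {σ : Equiv.Perm (Fin (k * l))} {P : KLPartition k l}
    {B : Finset (Fin (k * l))} : B.image σ ∈ (σ • P).1.parts ↔ B ∈ P.1.parts := by
  rw [smul_parts]
  exact (image_injective σ.injective).mem_finset_image

theorem partitionGraph_adj_smul (σ : Equiv.Perm (Fin (k * l))) (P Q : KLPartition k l) :
    (partitionGraph k l).Adj (σ • P) (σ • Q) ↔ (partitionGraph k l).Adj P Q := by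
  simp only [partitionGraph, smul_parts, forall_mem_image, ← image_inter _ _ σ.injective,
    card_image_of_injective _ σ.injective, ne_eq, smul_left_cancel_iff]

/-- The triple `S` lies inside a block of `P`. -/
abbrev IsMono (P : KLPartition k l) (S : Finset (Fin (k * l))) : Prop :=
  ∃ B ∈ P.1.parts, S ⊆ B

/-- The points of `S` lie in distinct blocks of `P`. -/
abbrev IsRainbow (P : KLPartition k l) (S : Finset (Fin (k * l))) : Prop :=
  ∀ B ∈ P.1.parts, (S ∩ B).card ≤ 1

theorem isMono_smul_iff {σ : Equiv.Perm (Fin (k * l))} {P : KLPartition k l}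
    {S : Finset (Fin (k * l))} : IsMono (σ • P) (S.image σ) ↔ IsMono P S := by
  simp only [IsMono, smul_parts, exists_mem_image, image_subset_image_iff σ.injective]

theorem isMonochromatic_part_iff {P : KLPartition k l} {S : Finset (Fin (k * l))}
    (hS : S.Nonempty) : IsMonochromatic P.1.part S ↔ IsMono P S := by
  constructor
  · intro h
    obtain ⟨a, ha⟩ := hS
    exact ⟨P.1.part a, P.1.part_mem.2 (mem_univ _), fun y hy => by
      rw [h a ha y hy]; exact P.1.mem_part (mem_univ _)⟩
  · rintro ⟨B, hB, hSB⟩ y hy z hz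
    rw [(P.1.part_eq_iff_mem hB).2 (hSB hy), (P.1.part_eq_iff_mem hB).2 (hSB hz)]

theorem isRainbowFor_part_iff {P : KLPartition k l} {S : Finset (Fin (k * l))} :
    IsRainbowFor P.1.part S ↔ IsRainbow P S := by
  constructor
  · intro h B hB
    refine card_le_one.2 fun y hy z hz => ?_
    rw [mem_inter] at hy hz
    exact h y hy.1 z hz.1 (by
      rw [(P.1.part_eq_iff_mem hB).2 hy.2, (P.1.part_eq_iff_mem hB).2 hz.2])
  · intro h y hy z hz hyz
    refine card_le_one.1 (h (P.1.part y) (P.1.part_mem.2 (mem_univ _))) y ?_ z ?_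
    · exact mem_inter.2 ⟨hy, P.1.mem_part (mem_univ _)⟩
    · exact mem_inter.2 ⟨hz, hyz ▸ P.1.mem_part (mem_univ _)⟩

/-- The number of blocks of `P` meeting `S` in exactly `j` points. -/
def profile (P : KLPartition k l) (S : Finset (Fin (k * l))) (j : ℕ) : ℕ :=
  ({B ∈ P.1.parts | (S ∩ B).card = j} : Finset _).card

theorem profile_smul (σ : Equiv.Perm (Fin (k * l))) (P : KLPartition k l)
    (S : Finset (Fin (k * l))) (j : ℕ) : profile (σ • P) (S.image σ) j = profile P S j := by
  unfold profile
  rw [smul_parts, filter_image, card_image_of_injective _ (image_injective σ.injective)]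
  simp only [← image_inter _ _ σ.injective, card_image_of_injective _ σ.injective]

/-- Two partitions with matching block intersections with given sets are related by a permutation
carrying one set to the other. -/
theorem exists_perm_of_parts_equiv {P Q : KLPartition k l} {S S' : Finset (Fin (k * l))}
    (φ : P.1.parts ≃ Q.1.parts) (hφ : ∀ B, (S' ∩ (φ B).1).card = (S ∩ B.1).card) :
    ∃ σ : Equiv.Perm (Fin (k * l)), σ • P = Q ∧ S.image σ = S' ∧
      ∀ B : P.1.parts, B.1.image σ = (φ B).1 := by
  have hP : ∀ x, P.1.part x ∈ P.1.parts := fun x => P.1.part_mem.2 (mem_univ _)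
  have hQ : ∀ x, Q.1.part x ∈ Q.1.parts := fun x => Q.1.part_mem.2 (mem_univ _)
  -- Colour each point by its block, transported by `φ`, and by membership in the given set. The
  -- colour classes are `B ∩ S` and `B \ S`, whose sizes match since all blocks have size `k`.
  obtain ⟨σ, hσ⟩ := exists_equiv_of_card_fiber
    (fun x => ((φ ⟨P.1.part x, hP x⟩, decide (x ∈ S)) : Q.1.parts × Bool))
    (fun x => ((⟨Q.1.part x, hQ x⟩, decide (x ∈ S')) : Q.1.parts × Bool)) (by
      rintro ⟨C, b⟩
      obtain ⟨B, rfl⟩ := φ.surjective C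
      have e1 : ∀ x, (⟨P.1.part x, hP x⟩ : P.1.parts) = B ↔ x ∈ B.1 := fun x => by
        rw [← P.1.part_eq_iff_mem B.2, Subtype.ext_iff]
      have e2 : ∀ x, (⟨Q.1.part x, hQ x⟩ : Q.1.parts) = φ B ↔ x ∈ (φ B).1 := fun x => by
        rw [← Q.1.part_eq_iff_mem (φ B).2, Subtype.ext_iff]
      simp only [Prod.mk.injEq, φ.apply_eq_iff_eq, e1, e2]
      cases b
      · have h1 : ({x | x ∈ B.1 ∧ decide (x ∈ S) = false} : Finset (Fin (k * l))) = B.1 \ S := by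
          ext; simp
        have h2 : ({x | x ∈ (φ B).1 ∧ decide (x ∈ S') = false} : Finset (Fin (k * l))) =
            (φ B).1 \ S' := by
          ext; simp
        rw [h1, h2, card_sdiff, card_sdiff, hφ, P.2.2 _ B.2, Q.2.2 _ (φ B).2]
      · have h1 : ({x | x ∈ B.1 ∧ decide (x ∈ S) = true} : Finset (Fin (k * l))) = S ∩ B.1 := by
          ext; simp [and_comm]
        have h2 : ({x | x ∈ (φ B).1 ∧ decide (x ∈ S') = true} : Finset (Fin (k * l))) =
            S' ∩ (φ B).1 := by
          ext; simp [and_comm]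
        rw [h1, h2, hφ])
  simp only [Prod.mk.injEq, decide_eq_decide] at hσ
  have himg : ∀ B : P.1.parts, B.1.image σ = (φ B).1 := by
    intro B
    refine eq_of_subset_of_card_le ?_ ?_
    · rw [image_subset_iff]
      intro x hx
      have := (hσ x).1
      rw [Subtype.ext_iff] at this
      have h3 : (⟨P.1.part x, hP x⟩ : P.1.parts) = B :=
        Subtype.ext ((P.1.part_eq_iff_mem B.2).2 hx)
      rw [h3] at this
      rw [← this]
      exact Q.1.mem_part (mem_univ _)
    · rw [card_image_of_injective _ σ.injective, P.2.2 _ B.2, Q.2.2 _ (φ B).2]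
  refine ⟨σ, ?_, ?_, himg⟩
  · apply Subtype.ext
    apply Finpartition.ext
    rw [smul_parts]
    ext C
    rw [mem_image]
    constructor
    · rintro ⟨B, hB, rfl⟩
      rw [himg ⟨B, hB⟩]
      exact (φ _).2
    · intro hC
      refine ⟨_, (φ.symm ⟨C, hC⟩).2, ?_⟩
      rw [himg, φ.apply_symm_apply]
  · ext y
    rw [mem_image]
    constructor
    · rintro ⟨x, hx, rfl⟩
      exact (hσ x).2.2 hx
    · intro hy
      refine ⟨σ.symm y, ?_, σ.apply_symm_apply y⟩
      rw [← (hσ (σ.symm y)).2, σ.apply_symm_apply]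
      exact hy

theorem exists_perm_of_profile {P Q : KLPartition k l} {S S' : Finset (Fin (k * l))}
    (h : ∀ j, profile P S j = profile Q S' j) :
    ∃ σ : Equiv.Perm (Fin (k * l)), σ • P = Q ∧ S.image σ = S' := by
  have key : ∀ (R : KLPartition k l) (T : Finset (Fin (k * l))) (j : ℕ),
      ({B : R.1.parts | (T ∩ B.1).card = j} : Finset _).card = profile R T j := by
    intro R T j
    rw [profile, ← card_map (Function.Embedding.subtype _)]
    congr 1
    ext
    simp [and_comm]
  obtain ⟨φ, hφ⟩ := exists_equiv_of_card_fiber (fun B : P.1.parts => (S ∩ B.1).card)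
    (fun B : Q.1.parts => (S' ∩ B.1).card) (fun j => by rw [key, key, h])
  obtain ⟨σ, h1, h2, -⟩ := exists_perm_of_parts_equiv φ hφ
  exact ⟨σ, h1, h2⟩

theorem sum_card_inter_parts (P : KLPartition k l) (S : Finset (Fin (k * l))) :
    ∑ B ∈ P.1.parts, (S ∩ B).card = S.card := by
  rw [card_eq_sum_card_fiberwise (f := P.1.part) (s := S) (t := P.1.parts)
    (fun x _ => P.1.part_mem.2 (mem_univ _))]
  refine sum_congr rfl fun B hB => congrArg card ?_
  ext x
  rw [mem_inter, mem_filter, P.1.part_eq_iff_mem hB]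

theorem profile_eq_zero_of_card_lt (P : KLPartition k l) {S : Finset (Fin (k * l))} {j : ℕ}
    (hj : S.card < j) : profile P S j = 0 := by
  rw [profile, card_eq_zero, filter_eq_empty_iff]
  intro B _ h
  exact (card_le_card (inter_subset_left (s₁ := S) (s₂ := B))).not_gt (h ▸ hj)

/-- Count the blocks, and count the points of `S` block by block. The second relation leaves only
(3,0,0), (1,1,0) and (0,0,1) for the profile at 1, 2, 3, so the value at 1 determines the whole
profile. -/
theorem profile_relations (P : KLPartition k l) {S : Finset (Fin (k * l))} (hS : S.card = 3) :
    profile P S 0 + profile P S 1 + profile P S 2 + profile P S 3 = l ∧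
      profile P S 1 + 2 * profile P S 2 + 3 * profile P S 3 = 3 := by
  have hm : ∀ B ∈ P.1.parts, (S ∩ B).card ∈ range 4 := fun B _ => mem_range.2 (by
    have := card_le_card (inter_subset_left (s₁ := S) (s₂ := B))
    omega)
  constructor
  · have := card_eq_sum_card_fiberwise (s := P.1.parts) (t := range 4)
      (f := fun B => (S ∩ B).card) (fun B hB => hm B hB)
    rw [P.2.1] at this
    simp only [sum_range_succ, sum_range_zero] at this
    unfold profile
    omega
  · have h1 := sum_fiberwise_of_maps_to hm (fun B => (S ∩ B).card)
    rw [sum_card_inter_parts, hS] at h1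
    have h2 : ∀ j ∈ range 4, ∑ B ∈ P.1.parts with (S ∩ B).card = j, (S ∩ B).card =
        profile P S j * j := fun j _ => by
      rw [sum_congr rfl fun B hB => (mem_filter.1 hB).2, sum_const, smul_eq_mul, profile]
    rw [sum_congr rfl h2] at h1
    simp only [sum_range_succ, sum_range_zero] at h1
    omega

theorem profile_one_mem (P : KLPartition k l) {S : Finset (Fin (k * l))} (hS : S.card = 3) :
    profile P S 1 = 0 ∨ profile P S 1 = 1 ∨ profile P S 1 = 3 := by
  have := profile_relations P hS
  omega

theorem exists_perm_of_profile_one {P Q : KLPartition k l} {S S' : Finset (Fin (k * l))}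
    (hS : S.card = 3) (hS' : S'.card = 3) (h : profile P S 1 = profile Q S' 1) :
    ∃ σ : Equiv.Perm (Fin (k * l)), σ • P = Q ∧ S.image σ = S' := by
  have h1 := profile_relations P hS
  have h2 := profile_relations Q hS'
  refine exists_perm_of_profile fun j => ?_
  rcases lt_or_ge 3 j with hj | hj
  · rw [profile_eq_zero_of_card_lt P (hS ▸ hj), profile_eq_zero_of_card_lt Q (hS' ▸ hj)]
  · interval_cases j <;> omega

theorem profile_one_of_isRainbow {P : KLPartition k l} {S : Finset (Fin (k * l))}
    (hS : S.card = 3) (h : IsRainbow P S) : profile P S 1 = 3 := by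
  have h1 := profile_relations P hS
  have h2 : profile P S 2 = 0 := by
    rw [profile, card_eq_zero, filter_eq_empty_iff]
    intro B hB h2
    have := h B hB
    omega
  have h3 : profile P S 3 = 0 := by
    rw [profile, card_eq_zero, filter_eq_empty_iff]
    intro B hB h2
    have := h B hB
    omega
  omega

theorem exists_smul_eq (P Q : KLPartition k l) : ∃ σ : Equiv.Perm (Fin (k * l)), σ • P = Q := by
  obtain ⟨σ, h, -⟩ := exists_perm_of_profile (P := P) (Q := Q) (S := ∅) (S' := ∅) (fun j => by
    simp only [profile, empty_inter, card_empty, filter_const]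
    split_ifs
    · rw [P.2.1, Q.2.1]
    · rfl)
  exact ⟨σ, h⟩

theorem exists_perm_image_eq {α : Type*} [Fintype α] [DecidableEq α] {S T : Finset α}
    (h : S.card = T.card) : ∃ σ : Equiv.Perm α, S.image σ = T := by
  obtain ⟨σ, hσ⟩ := exists_equiv_of_card_fiber (fun x => decide (x ∈ S))
    (fun x => decide (x ∈ T)) (by
      have : ∀ U : Finset α, ({x | x ∉ U} : Finset α) = Uᶜ := fun U => by ext; simp
      rintro (_ | _)
      · simp [this, card_compl, h]
      · simpa using h)
  refine ⟨σ, ?_⟩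
  ext y
  have := hσ (σ.symm y)
  simp only [σ.apply_symm_apply, decide_eq_decide] at this
  rw [this, mem_image]
  exact ⟨fun ⟨x, hx, e⟩ => by simpa [← e] using hx, fun hy => ⟨_, hy, σ.apply_symm_apply y⟩⟩

theorem nonempty_klPartition (hk : k ≠ 0) (hl : l ≠ 0) : Nonempty (KLPartition k l) := by
  obtain ⟨P, hP, hc⟩ := Finpartition.exists_equipartition_card_eq
    (univ : Finset (Fin (k * l))) hl (by
      rw [card_univ, Fintype.card_fin]
      exact Nat.le_mul_of_pos_left _ (Nat.pos_of_ne_zero hk))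
  -- Since `l` divides `k * l`, no block of the equipartition exceeds the average size `k`.
  have h0 := hP.card_large_parts_eq_mod
  rw [hc, card_univ, Fintype.card_fin, Nat.mul_mod_left, card_eq_zero, filter_eq_empty_iff,
    Nat.mul_div_cancel _ (Nat.pos_of_ne_zero hl)] at h0
  refine ⟨⟨P, hc, fun B hB => ?_⟩⟩
  have h1 := hP.card_parts_eq_average hB
  rw [hc, card_univ, Fintype.card_fin, Nat.mul_div_cancel _ (Nat.pos_of_ne_zero hl)] at h1
  exact h1.resolve_right (h0 hB)

end Partitions

/-! ### Block sums and their neighbour sums -/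

section BlockSum

open Finset

variable {k l : ℕ}

theorem block_eq_of_mem {P : KLPartition k l} {B C : Finset (Fin (k * l))} (hB : B ∈ P.1.parts)
    (hC : C ∈ P.1.parts) {x : Fin (k * l)} (hxB : x ∈ B) (hxC : x ∈ C) : B = C := by
  rw [← (P.1.part_eq_iff_mem hB).2 hxB, (P.1.part_eq_iff_mem hC).2 hxC]

/-- The sum of `g` over the triples contained in a block of `P`. -/
def blockSum (g : Finset (Fin (k * l)) → ℝ) (P : KLPartition k l) : ℝ :=
  ∑ S ∈ powersetCard 3 univ with IsMono P S, g S

theorem blockSum_smul (g : Finset (Fin (k * l)) → ℝ) (σ : Equiv.Perm (Fin (k * l)))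
    (P : KLPartition k l) : blockSum g (σ • P) = blockSum (fun S => g (S.image σ)) P := by
  refine (sum_bij (fun S _ => S.image σ) ?_ ?_ ?_ ?_).symm
  · intro S hS
    simpa [isMono_smul_iff, card_image_of_injective _ σ.injective] using hS
  · exact fun S _ T _ h => image_injective σ.injective h
  · intro S hS
    have e : (S.image σ.symm).image σ = S := by simp [image_image]
    refine ⟨S.image σ.symm, ?_, e⟩
    rw [mem_filter, mem_powersetCard_univ] at hS ⊢
    rw [card_image_of_injective _ σ.symm.injective, ← isMono_smul_iff (σ := σ), e]
    exact hS
  · exact fun _ _ => rfl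

theorem filter_isMonochromatic_part (P : KLPartition k l)
    {_ : DecidablePred (IsMonochromatic P.1.part)} {j : ℕ} (hj : j ≠ 0) :
    ({S ∈ powersetCard j (univ : Finset (Fin (k * l))) | IsMonochromatic P.1.part S} : Finset (Finset (Fin (k * l)))) =
      {S ∈ powersetCard j (univ : Finset (Fin (k * l))) | IsMono P S} := by
  refine filter_congr fun S hS => isMonochromatic_part_iff (card_ne_zero.1 ?_)
  rwa [mem_powersetCard_univ.1 hS]

theorem filter_isRainbowFor_part (P : KLPartition k l)
    {_ : DecidablePred (IsRainbowFor P.1.part)} (j : ℕ) :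
    ({S ∈ powersetCard j (univ : Finset (Fin (k * l))) | IsRainbowFor P.1.part S} :
      Finset (Finset (Fin (k * l)))) =
      {S ∈ powersetCard j (univ : Finset (Fin (k * l))) | IsRainbow P S} :=
  filter_congr fun _ _ => isRainbowFor_part_iff

theorem card_filter_isMono (P : KLPartition k l) {j : ℕ} (hj : j ≠ 0) :
    ({S ∈ powersetCard j univ | IsMono P S} : Finset (Finset (Fin (k * l)))).card =
      l * k.choose j := by
  have e : ({S ∈ powersetCard j univ | IsMono P S} : Finset (Finset (Fin (k * l)))) =
      P.1.parts.biUnion fun B => powersetCard j B := by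
    ext S
    simp only [mem_filter, mem_powersetCard, mem_biUnion, subset_univ, true_and]
    exact ⟨fun ⟨h, B, hB, hS⟩ => ⟨B, hB, hS, h⟩, fun ⟨B, hB, hS, h⟩ => ⟨h, B, hB, hS⟩⟩
  rw [e, card_biUnion]
  · rw [sum_congr rfl (fun B hB => by rw [card_powersetCard, P.2.2 B hB]), sum_const, P.2.1,
      smul_eq_mul]
  · intro B hB C hC hBC
    rw [Function.onFun, disjoint_left]
    intro S h1 h2
    rw [mem_powersetCard] at h1 h2
    obtain ⟨x, hx⟩ : S.Nonempty := card_ne_zero.1 (by omega)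
    exact hBC (block_eq_of_mem hB hC (h1.1 hx) (h2.1 hx))

theorem two_mul_blockSum_sub_sum_rainbow (g : Finset (Fin (k * l)) → ℝ) (P : KLPartition k l) :
    2 * blockSum g P - ∑ S ∈ powersetCard 3 univ with IsRainbow P S, g S =
      ∑ p ∈ powersetCard 2 univ with IsMono P p, ∑ x ∈ pᶜ, g (insert x p) -
        ∑ S ∈ powersetCard 3 univ, g S := by
  have h := two_mul_sum_monochromatic_sub_sum_rainbow P.1.part g
  rw [filter_isMonochromatic_part P (by norm_num), filter_isMonochromatic_part P (by norm_num),
    filter_isRainbowFor_part] at h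
  exact h

theorem IsHarmonic.sum_isRainbow {g : Finset (Fin (k * l)) → ℝ} (hg : IsHarmonic g)
    (P : KLPartition k l) :
    ∑ S ∈ powersetCard 3 univ with IsRainbow P S, g S = 2 * blockSum g P := by
  have h := hg.sum_rainbow P.1.part
  rw [filter_isMonochromatic_part P (by norm_num),
    filter_isRainbowFor_part] at h
  exact h

/-- With `g = 1` the double count reads `2 l C(k,3) - R = l C(k,2) (kl - 2) - C(kl,3)`; solve for
`R`. -/
theorem card_filter_isRainbow (P : KLPartition k l) :
    (({S ∈ powersetCard 3 univ | IsRainbow P S} : Finset (Finset (Fin (k * l)))).card : ℝ) =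
      (k : ℝ) ^ 3 * (l * (l - 1) * (l - 2)) / 6 := by
  have h := two_mul_blockSum_sub_sum_rainbow (fun _ => 1) P
  have hc3 : ∀ n : ℕ, (n.choose 3 : ℝ) = n * (n - 1) * (n - 2) / 6 := fun n => by
    rw [Nat.cast_choose_eq_descPochhammer_div]
    simp [descPochhammer_succ_right, Nat.factorial]
  have h1 : ∀ p ∈ ({p ∈ powersetCard 2 univ | IsMono P p} : Finset (Finset (Fin (k * l)))),
      ∑ x ∈ pᶜ, (1 : ℝ) = (k : ℝ) * l - 2 := fun p hp => by
    have h2 := mem_powersetCard_univ.1 (mem_filter.1 hp).1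
    have h3 := card_add_card_compl p
    rw [h2, Fintype.card_fin] at h3
    rw [sum_const, nsmul_eq_mul, mul_one, eq_sub_iff_add_eq, add_comm]
    exact_mod_cast h3
  rw [blockSum, sum_congr rfl h1] at h
  simp only [sum_const, nsmul_eq_mul, mul_one, card_filter_isMono P three_ne_zero,
    card_filter_isMono P two_ne_zero, card_powersetCard, card_univ, Fintype.card_fin] at h
  push_cast [hc3, Nat.cast_choose_two] at h
  linarith

open Classical in
/-- The number of neighbours of `P` having a block that contains `S`. -/
noncomputable def monoNeighborCount (P : KLPartition k l) (S : Finset (Fin (k * l))) : ℕ :=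
  ({Q | (partitionGraph k l).Adj P Q ∧ IsMono Q S} : Finset (KLPartition k l)).card

theorem monoNeighborCount_smul (σ : Equiv.Perm (Fin (k * l))) (P : KLPartition k l)
    (S : Finset (Fin (k * l))) :
    monoNeighborCount (σ • P) (S.image σ) = monoNeighborCount P S := by
  classical
  refine (card_equiv (MulAction.toPerm σ) fun Q => ?_).symm
  simp [partitionGraph_adj_smul, isMono_smul_iff, -exists_and_left]

/-- A block of a neighbour meets each block of `P` at most once, so any triple inside it is rainbow
for `P`. -/
theorem monoNeighborCount_of_not_isRainbow {P : KLPartition k l} {S : Finset (Fin (k * l))}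
    (h : ¬ IsRainbow P S) : monoNeighborCount P S = 0 := by
  classical
  rw [monoNeighborCount, card_eq_zero, filter_eq_empty_iff]
  rintro Q - ⟨hadj, C, hC, hSC⟩
  refine h fun B hB => ?_
  have := hadj.2 B hB C hC
  rw [inter_comm] at this
  exact (card_le_card (inter_subset_inter_right hSC)).trans this

/-- Permutations act transitively on pairs of a partition and a triple rainbow for it. -/
theorem monoNeighborCount_eq {P Q : KLPartition k l} {S T : Finset (Fin (k * l))}
    (hS : S.card = 3) (hT : T.card = 3) (hP : IsRainbow P S) (hQ : IsRainbow Q T) :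
    monoNeighborCount P S = monoNeighborCount Q T := by
  obtain ⟨σ, rfl, rfl⟩ := exists_perm_of_profile_one (P := P) (Q := Q) hS hT (by
    rw [profile_one_of_isRainbow hS hP, profile_one_of_isRainbow hT hQ])
  rw [monoNeighborCount_smul]

theorem exists_monoNeighborCount (k l : ℕ) : ∃ N : ℕ, ∀ (P : KLPartition k l)
    (S : Finset (Fin (k * l))), S.card = 3 →
      monoNeighborCount P S = if IsRainbow P S then N else 0 := by
  by_cases h : ∃ (P : KLPartition k l) (S : Finset (Fin (k * l))), S.card = 3 ∧ IsRainbow P S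
  · obtain ⟨P₀, S₀, hS₀, hR⟩ := h
    refine ⟨monoNeighborCount P₀ S₀, fun P S hS => ?_⟩
    split_ifs with hP
    · exact monoNeighborCount_eq hS hS₀ hP hR
    · exact monoNeighborCount_of_not_isRainbow hP
  · push Not at h
    exact ⟨0, fun P S hS => by
      rw [if_neg (h P S hS), monoNeighborCount_of_not_isRainbow (h P S hS)]⟩

open Classical in
theorem sum_neighbors_blockSum {N : ℕ} (hN : ∀ (P : KLPartition k l)
    (S : Finset (Fin (k * l))), S.card = 3 →
      monoNeighborCount P S = if IsRainbow P S then N else 0)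
    (g : Finset (Fin (k * l)) → ℝ) (P : KLPartition k l) :
    ∑ Q with (partitionGraph k l).Adj P Q, blockSum g Q =
      N * ∑ S ∈ powersetCard 3 univ with IsRainbow P S, g S := by
  unfold blockSum
  rw [sum_comm' (t' := powersetCard 3 univ)
    (s' := fun S => {Q | (partitionGraph k l).Adj P Q ∧ IsMono Q S}) (by
      intro Q S
      simp only [mem_filter, mem_univ, true_and]
      tauto), sum_filter, mul_sum]
  refine sum_congr rfl fun S hS => ?_
  have := hN P S (mem_powersetCard_univ.1 hS)
  rw [monoNeighborCount] at this
  rw [sum_const, this]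
  split_ifs <;> simp

/-! ### Injectivity of block sums on harmonic functions -/

theorem exists_perm_fixing_block {α : Type*} [Fintype α] [DecidableEq α] {B S T : Finset α}
    (hS : S ⊆ Bᶜ) (hT : T ⊆ Bᶜ) (h : S.card = T.card) :
    ∃ σ : Equiv.Perm α, B.image σ = B ∧ S.image σ = T := by
  have disj : ∀ U ⊆ Bᶜ, ∀ x ∈ U, x ∉ B := fun U hU x hx => mem_compl.1 (hU hx)
  have key : ∀ U ⊆ Bᶜ, ∀ c : Bool × Bool,
      ({x | (decide (x ∈ B), decide (x ∈ U)) = c} : Finset α).card =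
        match c with
        | (true, true) => 0
        | (true, false) => B.card
        | (false, true) => U.card
        | (false, false) => Fintype.card α - (B.card + U.card) := by
    rintro U hU ⟨_ | _, _ | _⟩
    · have : ({x | (decide (x ∈ B), decide (x ∈ U)) = (false, false)} : Finset α) = (B ∪ U)ᶜ := by
        ext; simp
      simp only [this, card_compl]
      rw [card_union_of_disjoint (disjoint_right.2 (disj U hU))]
    · exact congrArg card (by ext x; simp; exact disj U hU x)
    · exact congrArg card (by ext x; simp; exact fun h1 h2 => disj U hU x h2 h1)
    · simp only [Prod.mk.injEq, decide_eq_true_eq, card_eq_zero, filter_eq_empty_iff]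
      exact fun x _ h => disj U hU x h.2 h.1
  obtain ⟨σ, hσ⟩ := exists_equiv_of_card_fiber (fun x => (decide (x ∈ B), decide (x ∈ S)))
    (fun x => (decide (x ∈ B), decide (x ∈ T))) (fun c => by rw [key S hS, key T hT, h])
  simp only [Prod.mk.injEq, decide_eq_decide] at hσ
  refine ⟨σ, ?_, ?_⟩
  · ext y
    rw [mem_image]
    exact ⟨fun ⟨x, hx, e⟩ => e ▸ (hσ x).1.2 hx, fun hy => ⟨σ.symm y,
      (hσ _).1.1 (by rwa [σ.apply_symm_apply]), σ.apply_symm_apply y⟩⟩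
  · ext y
    rw [mem_image]
    exact ⟨fun ⟨x, hx, e⟩ => e ▸ (hσ x).2.2 hx, fun hy => ⟨σ.symm y,
      (hσ _).2.1 (by rwa [σ.apply_symm_apply]), σ.apply_symm_apply y⟩⟩

theorem exists_mem_parts (hk : k ≠ 0) (hl : l ≠ 0) {B : Finset (Fin (k * l))}
    (hB : B.card = k) : ∃ P : KLPartition k l, B ∈ P.1.parts := by
  obtain ⟨P⟩ := nonempty_klPartition hk hl
  obtain ⟨C, hC⟩ : P.1.parts.Nonempty := card_ne_zero.1 (by rwa [P.2.1])
  obtain ⟨σ, rfl⟩ := exists_perm_image_eq ((P.2.2 C hC).trans hB.symm)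
  exact ⟨σ • P, image_mem_smul_parts.2 hC⟩

/-- If the block sums of a harmonic function all vanish, then so do its sums over the triples in a
possible block. -/
theorem IsHarmonic.tripleSum_eq_zero_of_blockSum (hk : 2 ≤ k) (hl : 3 ≤ l)
    {g : Finset (Fin (k * l)) → ℝ} (hg : IsHarmonic g)
    (h : ∀ P : KLPartition k l, blockSum g P = 0) {B : Finset (Fin (k * l))} (hB : B.card = k) :
    tripleSum g B = 0 := by
  -- Sum the block sums over all partitions with `B` as a block; `c S` is the coefficient of `g S`.
  -- It equals `m` inside `B`, a constant `c T` outside `B`, and 0 for triples crossing `B`.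
  let c : Finset (Fin (k * l)) → ℕ := fun S =>
    ({P | B ∈ P.1.parts ∧ IsMono P S} : Finset (KLPartition k l)).card
  let m : ℕ := ({P | B ∈ P.1.parts} : Finset (KLPartition k l)).card
  obtain ⟨P, hBP⟩ := exists_mem_parts (by omega) (by omega) hB
  obtain ⟨C, hC, D, hD, hCD⟩ := one_lt_card.1 (show 1 < (P.1.parts.erase B).card by
    rw [card_erase_of_mem hBP, P.2.1]; omega)
  rw [mem_erase] at hC hD
  obtain ⟨x, hx⟩ : C.Nonempty := card_ne_zero.1 (by rw [P.2.2 C hC.2]; omega)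
  obtain ⟨y, hy, z, hz, hyz⟩ := one_lt_card.1 (show 1 < D.card by rw [P.2.2 D hD.2]; omega)
  have hxy : x ≠ y := by rintro rfl; exact hCD (block_eq_of_mem hC.2 hD.2 hx hy)
  have hxz : x ≠ z := by rintro rfl; exact hCD (block_eq_of_mem hC.2 hD.2 hx hz)
  -- `T` avoids `B` but is split between two other blocks of `P`, so `P` counts towards `m` and not
  -- towards `c T`. This strictness makes the factor `m - c T` nonzero.
  set T : Finset (Fin (k * l)) := {x, y, z} with hT
  have hT3 : T.card = 3 := card_eq_three.2 ⟨x, y, z, hxy, hxz, hyz, rfl⟩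
  have hTB : T ⊆ Bᶜ := by
    intro w hw
    rw [mem_compl]
    intro hwB
    simp only [hT, mem_insert, mem_singleton] at hw
    rcases hw with rfl | rfl | rfl
    · exact hC.1 (block_eq_of_mem hC.2 hBP hx hwB)
    · exact hD.1 (block_eq_of_mem hD.2 hBP hy hwB)
    · exact hD.1 (block_eq_of_mem hD.2 hBP hz hwB)
  have hlt : c T < m := by
    refine card_lt_card (ssubset_iff_of_subset ?_ |>.2 ⟨P, ?_, ?_⟩)
    · exact fun Q hQ => by
        rw [mem_filter] at hQ ⊢
        exact ⟨hQ.1, hQ.2.1⟩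
    · rw [mem_filter]
      exact ⟨mem_univ _, hBP⟩
    · rw [mem_filter]
      rintro ⟨-, -, E, hE, hTE⟩
      have h1 := block_eq_of_mem hE hC.2 (hTE (by simp [hT])) hx
      have h2 := block_eq_of_mem hE hD.2 (hTE (by simp [hT])) hy
      exact hCD (h1.symm.trans h2)
  have hc1 : ∀ S, S ⊆ B → c S = m := fun S hS =>
    congrArg card (filter_congr fun Q _ => ⟨fun h => h.1, fun h => ⟨h, B, h, hS⟩⟩)
  have hc2 : ∀ S, S.card = 3 → S ⊆ Bᶜ → c S = c T := fun S hS3 hS => by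
    obtain ⟨σ, hσB, hσT⟩ := exists_perm_fixing_block hS hTB (hS3.trans hT3.symm)
    refine card_equiv (MulAction.toPerm σ) fun Q => ?_
    rw [← hσT, mem_filter, mem_filter, MulAction.toPerm_apply, isMono_smul_iff]
    nth_rewrite 2 [← hσB]
    rw [image_mem_smul_parts]
    simp
  have hc3 : ∀ S, ¬ S ⊆ B → ¬ S ⊆ Bᶜ → c S = 0 := fun S h1 h2 => by
    refine card_eq_zero.2 (filter_eq_empty_iff.2 ?_)
    rintro Q - ⟨hBQ, E, hE, hSE⟩
    refine h2 fun w hw => mem_compl.2 fun hwB => h1 ?_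
    rw [block_eq_of_mem hBQ hE hwB (hSE hw)]
    exact hSE
  have hsum : ∑ Q with B ∈ Q.1.parts, blockSum g Q =
      ∑ S ∈ powersetCard 3 univ, (c S : ℝ) * g S := by
    unfold blockSum
    rw [sum_comm' (t' := powersetCard 3 univ)
      (s' := fun S => {Q | B ∈ Q.1.parts ∧ IsMono Q S}) (by
        intro Q S
        simp only [mem_filter, mem_univ, true_and]
        tauto)]
    exact sum_congr rfl fun S _ => by rw [sum_const, nsmul_eq_mul]
  have hval : ∀ S ∈ powersetCard 3 (univ : Finset (Fin (k * l))), (c S : ℝ) * g S =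
      m * (if S ⊆ B then g S else 0) + c T * (if S ⊆ Bᶜ then g S else 0) := fun S hS => by
    have hS3 := mem_powersetCard_univ.1 hS
    by_cases h1 : S ⊆ B
    · have h2 : ¬ S ⊆ Bᶜ := fun h2 => by
        obtain ⟨w, hw⟩ : S.Nonempty := card_ne_zero.1 (by omega)
        exact mem_compl.1 (h2 hw) (h1 hw)
      simp [h1, h2, hc1 S h1]
    · by_cases h2 : S ⊆ Bᶜ
      · simp [h1, h2, hc2 S hS3 h2]
      · simp [h1, h2, hc3 S h1 h2]
  have hfil : ∀ U : Finset (Fin (k * l)),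
      ∑ S ∈ powersetCard 3 univ, (if S ⊆ U then g S else 0) = tripleSum g U := fun U => by
    rw [← sum_filter, tripleSum]
    refine sum_congr ?_ fun _ _ => rfl
    ext S
    simp [mem_powersetCard, and_comm]
  rw [sum_eq_zero (fun Q _ => h Q), sum_congr rfl hval, sum_add_distrib, ← mul_sum, ← mul_sum,
    hfil, hfil, hg.tripleSum_compl] at hsum
  have hne : (m : ℝ) - c T ≠ 0 := sub_ne_zero.2 (by exact_mod_cast hlt.ne')
  exact (mul_eq_zero.1 (show ((m : ℝ) - c T) * tripleSum g B = 0 by linarith)).resolve_left hne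

theorem IsHarmonic.eq_zero_of_blockSum (hk : 3 ≤ k) (hl : 3 ≤ l)
    {g : Finset (Fin (k * l)) → ℝ} (hg : IsHarmonic g)
    (h : ∀ P : KLPartition k l, blockSum g P = 0) {S : Finset (Fin (k * l))} (hS : S.card = 3) :
    g S = 0 := by
  refine hg.eq_zero_of_tripleSum hk ?_
    (fun B hB => hg.tripleSum_eq_zero_of_blockSum (by omega) hl h hB) hS
  rw [Fintype.card_fin]
  nlinarith

/-- The witnesses are three points of one block, two points of one block and one of another, and
points of three blocks. This makes all three orbits occur. -/
theorem exists_profile_one_eq (hk : 3 ≤ k) (hl : 3 ≤ l) (P : KLPartition k l) {i : ℕ}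
    (hi : i = 0 ∨ i = 1 ∨ i = 3) :
    ∃ S : Finset (Fin (k * l)), S.card = 3 ∧ profile P S 1 = i := by
  obtain ⟨B, C, D, hB, hC, hD, hBC, hBD, hCD⟩ := two_lt_card_iff.1
    (show 2 < P.1.parts.card by rw [P.2.1]; omega)
  obtain ⟨x, y, z, hx, hy, hz, hxy, hxz, hyz⟩ := two_lt_card_iff.1
    (show 2 < B.card by rw [P.2.2 B hB]; omega)
  obtain ⟨c, hc⟩ : C.Nonempty := card_ne_zero.1 (by rw [P.2.2 C hC]; omega)
  obtain ⟨d, hd⟩ : D.Nonempty := card_ne_zero.1 (by rw [P.2.2 D hD]; omega)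
  have nBC : ∀ w ∈ B, w ∉ C := fun w h1 h2 => hBC (block_eq_of_mem hB hC h1 h2)
  have nBD : ∀ w ∈ B, w ∉ D := fun w h1 h2 => hBD (block_eq_of_mem hB hD h1 h2)
  have nCD : ∀ w ∈ C, w ∉ D := fun w h1 h2 => hCD (block_eq_of_mem hC hD h1 h2)
  have pos : ∀ (S : Finset (Fin (k * l))) (j : ℕ) (E : Finset (Fin (k * l))), E ∈ P.1.parts →
      (S ∩ E).card = j → 0 < profile P S j := fun S j E hE h =>
    card_pos.2 ⟨E, mem_filter.2 ⟨hE, h⟩⟩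
  rcases hi with rfl | rfl | rfl
  · have h3 : ({x, y, z} : Finset (Fin (k * l))).card = 3 :=
      card_eq_three.2 ⟨x, y, z, hxy, hxz, hyz, rfl⟩
    refine ⟨_, h3, ?_⟩
    have h1 := profile_relations P h3
    have h2 := pos {x, y, z} 3 B hB (by
      rw [inter_eq_left.2 (by grind), h3])
    omega
  · have h3 : ({x, y, c} : Finset (Fin (k * l))).card = 3 :=
      card_eq_three.2 ⟨x, y, c, by grind, by grind, by grind, rfl⟩
    refine ⟨_, h3, ?_⟩
    have h1 := profile_relations P h3
    have h2 := pos {x, y, c} 2 B hB (by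
      rw [show ({x, y, c} : Finset (Fin (k * l))) ∩ B = {x, y} by grind, card_pair hxy])
    omega
  · have h3 : ({x, c, d} : Finset (Fin (k * l))).card = 3 :=
      card_eq_three.2 ⟨x, c, d, by grind, by grind, by grind, rfl⟩
    refine ⟨_, h3, profile_one_of_isRainbow h3 ?_⟩
    rw [← isRainbowFor_part_iff]
    have e1 := (P.1.part_eq_iff_mem hB).2 hx
    have e2 := (P.1.part_eq_iff_mem hC).2 hc
    have e3 := (P.1.part_eq_iff_mem hD).2 hd
    simp only [IsRainbowFor, mem_insert, mem_singleton]
    grind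

end BlockSum

/-! ### The eigenspace and the value of the eigenvalue -/

section Spectrum

open Finset

variable {k l : ℕ}

/-- Functions on the `j`-element subsets of `Fin n`. -/
abbrev SubsetFunctions (n j : ℕ) : Type :=
  {S : Finset (Fin n) // S ∈ powersetCard j (univ : Finset (Fin n))} → ℝ

theorem finrank_subsetFunctions (n j : ℕ) :
    Module.finrank ℝ (SubsetFunctions n j) = n.choose j := by
  rw [Module.finrank_fintype_fun_eq_card, Fintype.card_coe, card_powersetCard, card_univ,
    Fintype.card_fin]

/-- Extension by zero of a function on triples to all finite sets. -/
noncomputable def extendTriples (n : ℕ) : SubsetFunctions n 3 →ₗ[ℝ] Finset (Fin n) → ℝ :=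
  Function.ExtendByZero.linearMap ℝ Subtype.val

theorem extendTriples_apply {n : ℕ} (f : SubsetFunctions n 3)
    (S : {S : Finset (Fin n) // S ∈ powersetCard 3 (univ : Finset (Fin n))}) :
    extendTriples n f S.1 = f S :=
  Subtype.val_injective.extend_apply _ _ _

/-- The map sending a function on triples to the function on pairs `p` that sums it over the
triples containing `p`. -/
noncomputable def pairSums (n : ℕ) : SubsetFunctions n 3 →ₗ[ℝ] SubsetFunctions n 2 :=
  LinearMap.pi fun p => ∑ x ∈ p.1ᶜ, LinearMap.proj (insert x p.1) ∘ₗ extendTriples n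

theorem isHarmonic_of_mem_ker_pairSums {n : ℕ} {f : SubsetFunctions n 3}
    (hf : f ∈ LinearMap.ker (pairSums n)) : IsHarmonic (extendTriples n f) := by
  intro p hp
  have := congrFun (LinearMap.mem_ker.1 hf) ⟨p, mem_powersetCard_univ.2 hp⟩
  simpa [pairSums] using this

theorem choose_sub_choose_le_finrank_ker_pairSums (n : ℕ) :
    (n.choose 3 : ℤ) - (n.choose 2 : ℤ) ≤ Module.finrank ℝ (LinearMap.ker (pairSums n)) := by
  have h1 := (pairSums n).finrank_range_add_finrank_ker
  have h2 := (LinearMap.range (pairSums n)).finrank_le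
  rw [finrank_subsetFunctions] at h1 h2
  omega

/-- `blockSum` as a linear map. -/
noncomputable def blockSumLinear (k l : ℕ) :
    (Finset (Fin (k * l)) → ℝ) →ₗ[ℝ] KLPartition k l → ℝ :=
  LinearMap.pi fun P => ∑ S ∈ powersetCard 3 univ with IsMono P S, LinearMap.proj S

theorem blockSumLinear_apply (g : Finset (Fin (k * l)) → ℝ) (P : KLPartition k l) :
    blockSumLinear k l g P = blockSum g P := by
  simp [blockSumLinear, blockSum]

open Classical in
theorem IsHarmonic.blockSumLinear_mem_eigenspace {N : ℕ} (hN : ∀ (P : KLPartition k l)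
    (S : Finset (Fin (k * l))), S.card = 3 →
      monoNeighborCount P S = if IsRainbow P S then N else 0)
    {g : Finset (Fin (k * l)) → ℝ} (hg : IsHarmonic g) :
    blockSumLinear k l g ∈ Module.End.eigenspace
      (Matrix.toLin' ((partitionGraph k l).adjMatrix ℝ)) (2 * N) := by
  rw [Module.End.mem_eigenspace_iff]
  ext P
  rw [Matrix.toLin'_apply, SimpleGraph.adjMatrix_mulVec_apply,
    SimpleGraph.neighborFinset_eq_filter]
  simp only [blockSumLinear_apply, Pi.smul_apply, smul_eq_mul]
  rw [sum_neighbors_blockSum hN, hg.sum_isRainbow]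
  ring

open Classical in
theorem choose_sub_choose_le_finrank_eigenspace (hk : 3 ≤ k) (hl : 3 ≤ l) {N : ℕ}
    (hN : ∀ (P : KLPartition k l) (S : Finset (Fin (k * l))), S.card = 3 →
      monoNeighborCount P S = if IsRainbow P S then N else 0) :
    ((k * l).choose 3 : ℤ) - ((k * l).choose 2 : ℤ) ≤
      Module.finrank ℝ (Module.End.eigenspace
        (Matrix.toLin' ((partitionGraph k l).adjMatrix ℝ)) (2 * N)) := by
  refine (choose_sub_choose_le_finrank_ker_pairSums (k * l)).trans (Nat.cast_le.2 ?_)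
  let L := ((blockSumLinear k l ∘ₗ extendTriples (k * l)).domRestrict
    (LinearMap.ker (pairSums (k * l)))).codRestrict
    (Module.End.eigenspace (Matrix.toLin' ((partitionGraph k l).adjMatrix ℝ)) (2 * N))
    (fun f => (isHarmonic_of_mem_ker_pairSums f.2).blockSumLinear_mem_eigenspace hN)
  refine LinearMap.finrank_le_finrank_of_injective (f := L) ?_
  rw [← LinearMap.ker_eq_bot, LinearMap.ker_eq_bot']
  intro f hf
  have h0 : ∀ P, blockSum (extendTriples (k * l) f.1) P = 0 := fun P => by
    rw [← blockSumLinear_apply]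
    exact congrFun (congrArg Subtype.val hf) P
  ext S
  exact (extendTriples_apply f.1 S).symm.trans
    ((isHarmonic_of_mem_ker_pairSums f.2).eq_zero_of_blockSum hk hl h0
      (mem_powersetCard_univ.1 S.2))

open Classical in
theorem exists_isRegularOfDegree_partitionGraph (k l : ℕ) :
    ∃ d, (partitionGraph k l).IsRegularOfDegree d := by
  rcases isEmpty_or_nonempty (KLPartition k l) with h | ⟨⟨P⟩⟩
  · exact ⟨0, fun P => h.elim P⟩
  · refine ⟨(partitionGraph k l).degree P, fun Q => ?_⟩
    obtain ⟨σ, rfl⟩ := exists_smul_eq P Q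
    rw [← SimpleGraph.card_neighborFinset_eq_degree, ← SimpleGraph.card_neighborFinset_eq_degree]
    refine (card_equiv (MulAction.toPerm σ) fun R => ?_).symm
    simp [partitionGraph_adj_smul]

-- The neighbour sum for `g = 1` gives `d l C(k,3) = N k³ l (l - 1) (l - 2) / 6`.
open Classical in
theorem monoNeighborCount_eq_degree_formula (hk : 3 ≤ k) (hl : 3 ≤ l) {N d : ℕ}
    (hN : ∀ (P : KLPartition k l) (S : Finset (Fin (k * l))), S.card = 3 →
      monoNeighborCount P S = if IsRainbow P S then N else 0)
    (hd : (partitionGraph k l).IsRegularOfDegree d) :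
    (2 * N : ℝ) = 2 * ((k : ℝ) - 1) * ((k : ℝ) - 2) * (d : ℝ) /
      ((k : ℝ) ^ 2 * ((l : ℝ) - 1) * ((l : ℝ) - 2)) := by
  obtain ⟨P⟩ := nonempty_klPartition (k := k) (l := l) (by omega) (by omega)
  have h := sum_neighbors_blockSum hN (fun _ => 1) P
  have hP := hd P
  rw [← SimpleGraph.card_neighborFinset_eq_degree, SimpleGraph.neighborFinset_eq_filter] at hP
  simp only [blockSum, sum_const, nsmul_eq_mul, mul_one, card_filter_isMono _ three_ne_zero, hP,
    card_filter_isRainbow] at h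
  have hc : (k.choose 3 : ℝ) = k * (k - 1) * (k - 2) / 6 := by
    rw [Nat.cast_choose_eq_descPochhammer_div]
    simp [descPochhammer_succ_right, Nat.factorial]
  push_cast [hc] at h
  have hk' : (3 : ℝ) ≤ k := by exact_mod_cast hk
  have hl' : (3 : ℝ) ≤ l := by exact_mod_cast hl
  have h1 : (l : ℝ) - 1 ≠ 0 := by linarith
  have h2 : (l : ℝ) - 2 ≠ 0 := by linarith
  have h3 : (k : ℝ) ≠ 0 := by linarith
  have h4 : (l : ℝ) ≠ 0 := by linarith
  rw [eq_div_iff (by positivity)]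
  refine mul_left_cancel₀ (mul_ne_zero h3 h4) ?_
  linarith

/-! ### Orbits of the stabiliser and the quotient matrix -/

/-- The set of the first three points. -/
abbrev firstThree (n : ℕ) : Finset (Fin n) := {x | x.val < 3}

theorem card_firstThree {n : ℕ} (hn : 3 ≤ n) : (firstThree n).card = 3 := by
  rw [Fin.card_filter_val_lt]
  omega

theorem mem_firstThreeStabilizer_iff {n : ℕ} {σ : Equiv.Perm (Fin n)} :
    σ ∈ firstThreeStabilizer n ↔ (firstThree n).image σ = firstThree n := by
  rw [MulAction.mem_stabilizer_iff, ← coe_inj, coe_image, coe_filter]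
  simp only [mem_univ, true_and]
  rfl

theorem firstThreeOrbit_mk_eq_iff {P Q : KLPartition k l} :
    (Quotient.mk _ P : FirstThreeOrbit k l) = Quotient.mk _ Q ↔
      ∃ σ : Equiv.Perm (Fin (k * l)),
        (firstThree (k * l)).image σ = firstThree (k * l) ∧ σ • Q = P := by
  rw [Quotient.eq, MulAction.orbitRel_apply]
  constructor
  · rintro ⟨⟨σ, hσ⟩, h⟩
    exact ⟨σ, mem_firstThreeStabilizer_iff.1 hσ, h⟩
  · rintro ⟨σ, hσ, h⟩
    exact ⟨⟨σ, mem_firstThreeStabilizer_iff.2 hσ⟩, h⟩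

theorem card_firstThreeOrbit (hk : 3 ≤ k) (hl : 3 ≤ l) :
    Nat.card (FirstThreeOrbit k l) = 3 := by
  have h3 : (firstThree (k * l)).card = 3 := card_firstThree (by nlinarith)
  -- The number of blocks meeting the fixed triple exactly once is a complete orbit invariant.
  let φ : FirstThreeOrbit k l → ({0, 1, 3} : Finset ℕ) :=
    Quotient.lift (fun P => ⟨profile P (firstThree (k * l)) 1, by
      simpa using profile_one_mem P h3⟩) (by
        intro P Q h
        obtain ⟨σ, hσ, rfl⟩ := firstThreeOrbit_mk_eq_iff.1 (Quotient.sound h)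
        rw [Subtype.mk.injEq]
        nth_rewrite 1 [← hσ]
        exact profile_smul σ Q _ _)
  have hφ : Function.Bijective φ := by
    constructor
    · intro i j
      induction i using Quotient.inductionOn with | h P =>
      induction j using Quotient.inductionOn with | h Q =>
      intro h
      obtain ⟨σ, h1, h2⟩ := exists_perm_of_profile_one h3 h3 (congrArg Subtype.val h).symm
      exact firstThreeOrbit_mk_eq_iff.2 ⟨σ, h2, h1⟩
    · rintro ⟨i, hi⟩
      obtain ⟨P⟩ := nonempty_klPartition (k := k) (l := l) (by omega) (by omega)
      -- Any partition will do: find a triple of the required type for it, then move that triple to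
      -- the first three points.
      obtain ⟨S, hS, rfl⟩ := exists_profile_one_eq hk hl P (by simpa using hi)
      obtain ⟨σ, hσ⟩ := exists_perm_image_eq (hS.trans h3.symm)
      refine ⟨Quotient.mk _ (σ • P), Subtype.ext ?_⟩
      change profile (σ • P) (firstThree (k * l)) 1 = _
      rw [← hσ, profile_smul]
  rw [Nat.card_congr (Equiv.ofBijective φ hφ), Nat.card_eq_fintype_card, Fintype.card_coe]
  rfl

-- On functions constant on cells, the quotient matrix acts as the adjacency matrix does.
open Classical in
theorem IsQuotientMatrix.mulVec_apply {V I : Type*} [Fintype V] [Fintype I] {G : SimpleGraph V}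
    {c : V → I} {M : Matrix I I ℝ} (h : IsQuotientMatrix G c M) (x : I → ℝ) (v : V) :
    M.mulVec x (c v) = ∑ w with G.Adj v w, x (c w) := by
  rw [← sum_fiberwise _ c, Matrix.mulVec, dotProduct]
  refine sum_congr rfl fun j _ => ?_
  rw [h v j, Set.ncard_eq_toFinset_card', sum_congr rfl fun w hw => by rw [(mem_filter.1 hw).2],
    sum_const, nsmul_eq_mul, filter_filter, Set.toFinset_ofPred]

/-- The quotient matrix of the orbits of the stabiliser of the first three points. -/
noncomputable def orbitQuotientMatrix (k l : ℕ) :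
    Matrix (FirstThreeOrbit k l) (FirstThreeOrbit k l) ℝ := fun i j =>
  (({w | (partitionGraph k l).Adj i.out w ∧
    (Quotient.mk _ w : FirstThreeOrbit k l) = j} : Set (KLPartition k l)).ncard : ℕ)

theorem isQuotientMatrix_orbitQuotientMatrix (k l : ℕ) :
    IsQuotientMatrix (partitionGraph k l) (fun P => (Quotient.mk _ P : FirstThreeOrbit k l))
      (orbitQuotientMatrix k l) := by
  intro v j
  -- A stabiliser element carrying `v` to the chosen representative preserves both adjacency and
  -- every orbit, so the neighbour counts agree.
  obtain ⟨σ, hσ, hv⟩ := firstThreeOrbit_mk_eq_iff.1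
    (Quotient.out_eq (Quotient.mk _ v : FirstThreeOrbit k l)).symm
  rw [orbitQuotientMatrix, ← Set.ncard_image_of_injective _ (MulAction.injective σ)]
  congr 2
  ext w
  have hmk : ∀ u : KLPartition k l,
      (Quotient.mk _ (σ • u) : FirstThreeOrbit k l) = Quotient.mk _ u := fun u =>
    firstThreeOrbit_mk_eq_iff.2 ⟨σ, hσ, rfl⟩
  constructor
  · rintro ⟨u, ⟨hu, rfl⟩, rfl⟩
    refine ⟨?_, hmk u⟩
    have := (partitionGraph_adj_smul σ _ _).2 hu
    rwa [hv] at this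
  · rintro ⟨hw, rfl⟩
    refine ⟨σ⁻¹ • w, ⟨?_, ?_⟩, smul_inv_smul σ w⟩
    · rwa [← partitionGraph_adj_smul σ, smul_inv_smul, hv]
    · rw [← hmk, smul_inv_smul]

theorem blockSum_zonalHarmonic_smul {S₀ : Finset (Fin (k * l))} {σ : Equiv.Perm (Fin (k * l))}
    (hσ : S₀.image σ = S₀) (P : KLPartition k l) :
    blockSum (zonalHarmonic S₀) (σ • P) = blockSum (zonalHarmonic S₀) P := by
  rw [blockSum_smul]
  congr 1
  ext S
  unfold zonalHarmonic
  nth_rewrite 1 [← hσ]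
  rw [← image_inter _ _ σ.injective, card_image_of_injective _ σ.injective]

theorem exists_blockSum_zonalHarmonic_ne_zero (hk : 3 ≤ k) (hl : 3 ≤ l)
    {S₀ : Finset (Fin (k * l))} (hS₀ : S₀.card = 3) :
    ∃ P : KLPartition k l, blockSum (zonalHarmonic S₀) P ≠ 0 := by
  by_contra! h
  refine zonalHarmonic_self_ne_zero hS₀ ?_
    ((isHarmonic_zonalHarmonic hS₀).eq_zero_of_blockSum hk hl h hS₀)
  rw [Fintype.card_fin]
  nlinarith

open Classical in
theorem hasEigenvalue_adjMatrix_partitionGraph (hk : 3 ≤ k) (hl : 3 ≤ l) {N : ℕ}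
    (hN : ∀ (P : KLPartition k l) (S : Finset (Fin (k * l))), S.card = 3 →
      monoNeighborCount P S = if IsRainbow P S then N else 0) :
    Module.End.HasEigenvalue (Matrix.toLin' ((partitionGraph k l).adjMatrix ℝ)) (2 * N) := by
  have h3 : (firstThree (k * l)).card = 3 := card_firstThree (by nlinarith)
  obtain ⟨P, hP⟩ := exists_blockSum_zonalHarmonic_ne_zero hk hl h3
  refine Module.End.hasEigenvalue_of_hasEigenvector
    ⟨(isHarmonic_zonalHarmonic h3).blockSumLinear_mem_eigenspace hN, fun h => hP ?_⟩
  rw [← blockSumLinear_apply, h, Pi.zero_apply]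

open Classical in
theorem hasEigenvalue_of_isQuotientMatrix (hk : 3 ≤ k) (hl : 3 ≤ l) {N : ℕ}
    (hN : ∀ (P : KLPartition k l) (S : Finset (Fin (k * l))), S.card = 3 →
      monoNeighborCount P S = if IsRainbow P S then N else 0)
    {M : Matrix (FirstThreeOrbit k l) (FirstThreeOrbit k l) ℝ}
    (hM : IsQuotientMatrix (partitionGraph k l)
      (fun P => (Quotient.mk _ P : FirstThreeOrbit k l)) M) :
    Module.End.HasEigenvalue (Matrix.toLin' M) (2 * N) := by
  have h3 : (firstThree (k * l)).card = 3 := card_firstThree (by nlinarith)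
  -- The eigenvector is the block sum of the zonal harmonic, which is constant on orbits.
  let x : FirstThreeOrbit k l → ℝ := Quotient.lift
    (fun P => blockSum (zonalHarmonic (firstThree (k * l))) P) (by
      intro P Q h
      obtain ⟨σ, hσ, rfl⟩ := firstThreeOrbit_mk_eq_iff.1 (Quotient.sound h)
      exact blockSum_zonalHarmonic_smul hσ Q)
  obtain ⟨P, hP⟩ := exists_blockSum_zonalHarmonic_ne_zero hk hl h3
  refine Module.End.hasEigenvalue_of_hasEigenvector (x := x)
    ⟨Module.End.mem_eigenspace_iff.2 ?_, fun h => hP (congrFun h (Quotient.mk _ P))⟩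
  ext i
  induction i using Quotient.inductionOn with | h Q =>
  rw [Matrix.toLin'_apply]
  refine (hM.mulVec_apply x Q).trans ?_
  refine (sum_neighbors_blockSum hN _ Q).trans ?_
  rw [(isHarmonic_zonalHarmonic h3).sum_isRainbow]
  change _ = (2 * N : ℝ) * blockSum _ Q
  ring

end Spectrum

open Classical in
theorem mainTheorem5 (k l : ℕ) (hk : 3 ≤ k) (hl : 3 ≤ l) :
    ∃ d : ℕ, (partitionGraph k l).IsRegularOfDegree d ∧
      ∃ θ : ℝ, θ = 2 * ((k : ℝ) - 1) * ((k : ℝ) - 2) * (d : ℝ) /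
          ((k : ℝ) ^ 2 * ((l : ℝ) - 1) * ((l : ℝ) - 2)) ∧
        Module.End.HasEigenvalue (Matrix.toLin' ((partitionGraph k l).adjMatrix ℝ)) θ ∧
        ((k * l).choose 3 : ℤ) - ((k * l).choose 2 : ℤ) ≤
          (Module.finrank ℝ (Module.End.eigenspace
            (Matrix.toLin' ((partitionGraph k l).adjMatrix ℝ)) θ) : ℤ) ∧
        Nat.card (FirstThreeOrbit k l) = 3 ∧
        ∃ M : Matrix (FirstThreeOrbit k l) (FirstThreeOrbit k l) ℝ,
          IsQuotientMatrix (partitionGraph k l)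
            (fun P => (Quotient.mk _ P : FirstThreeOrbit k l)) M ∧
          Module.End.HasEigenvalue (Matrix.toLin' M) θ := by
  obtain ⟨d, hd⟩ := exists_isRegularOfDegree_partitionGraph k l
  obtain ⟨N, hN⟩ := exists_monoNeighborCount k l
  have hM := isQuotientMatrix_orbitQuotientMatrix k l
  exact ⟨d, hd, 2 * N, monoNeighborCount_eq_degree_formula hk hl hN hd,
    hasEigenvalue_adjMatrix_partitionGraph hk hl hN,
    choose_sub_choose_le_finrank_eigenspace hk hl hN, card_firstThreeOrbit hk hl,
    _, hM, hasEigenvalue_of_isQuotientMatrix hk hl hN hM⟩
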